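/- Let $k$ be a field, let $Q=(Q_0,Q_1)$ be a finite quiver and let $s\ge 1$ be an integer. Let $Q^{(s)}$ be the quiver with vertices $i_t$ for $i\in Q_0$ and $1\le t\le s$, with a vertical arrow $b(i_t)\colon i_t\to i_{t+1}$ for each $i\in Q_0$ and $1\le t\le s-1$, and with a diagonal arrow $a_t\colon i_t\to j_{t-1}$ for each arrow $(a\colon i\to j)\in Q_1$ and $2\le t\le s$. Paths are composed from right to left. Let $\mathfrak I$ be the two-sided ideal of the path algebra $kQ^{(s)}$ generated by the elements $$a_{t+1}\,b(i_t)-b(j_{t-1})\,a_t\quad\text{for } (a\colon i\to j)\in Q_1,\ 1<t<s,$$ $$a_2\,b(i_1)\quad\text{for } (a\colon i\to j)\in Q_1\quad(\text{if } s\ge 2),$$ and let $N_s(Q):=kQ^{(s)}/\mathfrak I$ be the nilpotent quiver algebra. Then $N_s(Q)$ has global dimension at most $2$; that is, every left $N_s(Q)$-module has projective dimension at most $2$. -/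

import Mathlib

open CategoryTheory

universe w v u uk

noncomputable section

/-! ### Path algebras -/

/-- All paths of a quiver, including the trivial ones: start, end, path. -/
abbrev QPath (V : Type u) [Quiver.{v} V] : Type max u v :=
  Σ i j : V, Quiver.Path i j

/-- The path algebra `k V` as a vector space: the paths of `V` form a basis. -/
def PathAlgebra (k : Type uk) (V : Type u) [Field k] [Quiver.{v} V] : Type max uk u v :=
  QPath V →₀ k

namespace PathAlgebra

section Mul

variable (k : Type uk) {V : Type u} [Field k] [Quiver.{v} V]

instance : AddCommGroup (PathAlgebra k V) := inferInstanceAs (AddCommGroup (QPath V →₀ k))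

instance : Module k (PathAlgebra k V) := inferInstanceAs (Module k (QPath V →₀ k))

/-- The basis element given by a path. -/
def ofPath {i j : V} (p : Quiver.Path i j) : PathAlgebra k V :=
  Finsupp.single (⟨i, j, p⟩ : QPath V) (1 : k)

/-- The trivial path at a vertex. -/
def idem (i : V) : PathAlgebra k V := ofPath k (Quiver.Path.nil : Quiver.Path i i)

/-- The path of length one given by an arrow. -/
def ofArrow {i j : V} (a : i ⟶ j) : PathAlgebra k V := ofPath k a.toPath

variable (V) in
/-- The path basis of the path algebra. -/
def basis : Module.Basis (QPath V) k (PathAlgebra k V) :=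
  Module.Basis.ofRepr (LinearEquiv.refl k (QPath V →₀ k))

theorem basis_apply (p : QPath V) : basis k V p = ofPath k p.2.2 := rfl

open Classical in
/-- Product of two paths, composed from right to left: `q * p` is "first `p`, then `q`" if `p` ends
where `q` starts, and `0` otherwise. -/
def mulPath (q p : QPath V) : PathAlgebra k V :=
  if h : p.2.1 = q.1 then ofPath k (p.2.2.comp (q.2.2.cast h.symm rfl)) else 0

/-- The bilinear extension of `mulPath`. -/
def mulLin : PathAlgebra k V →ₗ[k] PathAlgebra k V →ₗ[k] PathAlgebra k V :=
  (basis k V).constr k fun q => (basis k V).constr k fun p => mulPath k q p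

instance : Mul (PathAlgebra k V) := ⟨fun x y => mulLin k x y⟩

theorem mul_def (x y : PathAlgebra k V) : x * y = mulLin k x y := rfl

theorem basis_mul_basis (q p : QPath V) : basis k V q * basis k V p = mulPath k q p := by
  rw [mul_def, mulLin, Module.Basis.constr_basis, Module.Basis.constr_basis]

theorem ofPath_mul_ofPath {i j l : V} (q : Quiver.Path j l) (p : Quiver.Path i j) :
    ofPath k q * ofPath k p = ofPath k (p.comp q) := by
  have h := basis_mul_basis k (⟨j, l, q⟩ : QPath V) ⟨i, j, p⟩
  simpa [basis_apply, mulPath] using h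

theorem ofPath_mul_ofPath_of_ne {i j j' l : V} (q : Quiver.Path j' l) (p : Quiver.Path i j)
    (h : j ≠ j') : ofPath k q * ofPath k p = 0 := by
  have h' := basis_mul_basis k (⟨j', l, q⟩ : QPath V) ⟨i, j, p⟩
  simpa [basis_apply, mulPath, h] using h'

theorem mul_assoc_aux (x y z : PathAlgebra k V) : x * y * z = x * (y * z) := by
  have key : (mulLin k).compr₂ (mulLin k) =
      (LinearMap.lcomp k _ (mulLin k)) ∘ₗ
        (LinearMap.llcomp k (PathAlgebra k V) (PathAlgebra k V) (PathAlgebra k V)) ∘ₗ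
          (mulLin k (V := V)) := by
    refine (basis k V).ext fun r => (basis k V).ext fun q => (basis k V).ext fun p => ?_
    change basis k V r * basis k V q * basis k V p = basis k V r * (basis k V q * basis k V p)
    obtain ⟨r1, r2, r⟩ := r
    obtain ⟨q1, q2, q⟩ := q
    obtain ⟨p1, p2, p⟩ := p
    simp only [basis_apply]
    by_cases h1 : q2 = r1
    · subst h1
      by_cases h2 : p2 = q1
      · subst h2
        simp only [ofPath_mul_ofPath, Quiver.Path.comp_assoc]
      · rw [ofPath_mul_ofPath, ofPath_mul_ofPath_of_ne _ _ _ h2, ofPath_mul_ofPath_of_ne _ _ _ h2,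
          mul_def, map_zero]
    · rw [ofPath_mul_ofPath_of_ne _ _ _ h1, mul_def, map_zero, LinearMap.zero_apply]
      by_cases h2 : p2 = q1
      · subst h2
        rw [ofPath_mul_ofPath, ofPath_mul_ofPath_of_ne _ _ _ h1]
      · rw [ofPath_mul_ofPath_of_ne _ _ _ h2, mul_def, map_zero]
  exact LinearMap.congr_fun (LinearMap.congr_fun (LinearMap.congr_fun key x) y) z

end Mul

section Ring

variable (k : Type uk) {V : Type u} [Field k] [Quiver.{v} V] [Fintype V]

/-- The unit is the sum of all trivial paths. -/
instance : One (PathAlgebra k V) := ⟨∑ i : V, idem k i⟩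

theorem one_def : (1 : PathAlgebra k V) = ∑ i : V, idem k i := rfl

theorem one_mul_aux (x : PathAlgebra k V) : 1 * x = x := by
  have key : mulLin k (1 : PathAlgebra k V) = LinearMap.id := by
    refine (basis k V).ext fun p => ?_
    rw [one_def, map_sum, LinearMap.sum_apply, basis_apply, LinearMap.id_apply,
      Finset.sum_eq_single p.2.1]
    · exact (ofPath_mul_ofPath k _ _).trans (by rw [Quiver.Path.comp_nil])
    · intro i _ hi
      exact ofPath_mul_ofPath_of_ne k _ _ hi.symm
    · intro h; exact absurd (Finset.mem_univ _) h
  exact LinearMap.congr_fun key x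

theorem mul_one_aux (x : PathAlgebra k V) : x * 1 = x := by
  have key : (mulLin k).flip (1 : PathAlgebra k V) = LinearMap.id := by
    refine (basis k V).ext fun p => ?_
    rw [LinearMap.flip_apply, one_def, map_sum, basis_apply, LinearMap.id_apply,
      Finset.sum_eq_single p.1]
    · exact (ofPath_mul_ofPath k _ _).trans (by rw [Quiver.Path.nil_comp])
    · intro i _ hi
      exact ofPath_mul_ofPath_of_ne k _ _ hi
    · intro h; exact absurd (Finset.mem_univ _) h
  exact LinearMap.congr_fun key x

instance : Ring (PathAlgebra k V) :=
  { (inferInstance : AddCommGroup (PathAlgebra k V)),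
    (inferInstance : Mul (PathAlgebra k V)),
    (inferInstance : One (PathAlgebra k V)) with
    mul_assoc := mul_assoc_aux k
    one_mul := one_mul_aux k
    mul_one := mul_one_aux k
    left_distrib := fun x y z => map_add (mulLin k x) y z
    right_distrib := fun x y z => LinearMap.map_add₂ (mulLin k) x y z
    zero_mul := fun x => LinearMap.map_zero₂ (mulLin k) x
    mul_zero := fun x => map_zero (mulLin k x) }

instance : Algebra k (PathAlgebra k V) :=
  Algebra.ofModule (fun r x y => LinearMap.map_smul₂ (mulLin k) r x y)
    (fun r x y => map_smul (mulLin k x) r y)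

end Ring

end PathAlgebra

/-! ### The staircase quiver -/

/-- The vertices `i_t` of the staircase quiver `Q^(s)`: `i` a vertex of `Q` and `1 ≤ t ≤ s`. -/
@[ext]
structure Staircase (V : Type u) (s : ℕ) : Type u where
  base : V
  level : ℕ
  one_le : 1 ≤ level
  le_s : level ≤ s

namespace Staircase

section

variable {V : Type u} {s : ℕ}

instance [Fintype V] : Fintype (Staircase V s) :=
  Fintype.ofInjective (β := V × Fin (s + 1))
    (fun x => (x.base, ⟨x.level, Nat.lt_succ_of_le x.le_s⟩)) (by
      intro x y h
      simp only [Prod.mk.injEq, Fin.mk.injEq] at h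
      exact Staircase.ext h.1 h.2)

/-- Arrows of the staircase quiver: the vertical arrows `b(i_t) : i_t ⟶ i_{t+1}`, and for every
arrow `a : i ⟶ j` of `Q` the diagonal arrows `a_t : i_t ⟶ j_{t-1}`. -/
inductive Arrow [Quiver.{v} V] (x y : Staircase V s) : Type v
  | vertical (hbase : x.base = y.base) (hlevel : y.level = x.level + 1) : Arrow x y
  | diagonal (a : x.base ⟶ y.base) (hlevel : x.level = y.level + 1) : Arrow x y

instance [Quiver.{v} V] : Quiver.{v} (Staircase V s) := ⟨Arrow⟩

variable (k : Type uk) [Field k] [Quiver.{v} V]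

/-- The vertical arrow `b(i_t) : i_t ⟶ i_{t+1}`, for `1 ≤ t < s`, in the path algebra. -/
def vert (i : V) (t : ℕ) (h1 : 1 ≤ t) (hs : t < s) : PathAlgebra k (Staircase V s) :=
  PathAlgebra.ofArrow k
    (Arrow.vertical rfl rfl :
      (⟨i, t, h1, hs.le⟩ : Staircase V s) ⟶ ⟨i, t + 1, Nat.le_add_left 1 t, hs⟩)

/-- The diagonal arrow `a_t : i_t ⟶ j_{t-1}`, for `a : i ⟶ j` and `2 ≤ t ≤ s`, in the path
algebra. -/
def diag {i j : V} (a : i ⟶ j) (t : ℕ) (h2 : 2 ≤ t) (hs : t ≤ s) :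
    PathAlgebra k (Staircase V s) :=
  PathAlgebra.ofArrow k
    (Arrow.diagonal a (by dsimp only; omega) :
      (⟨i, t, by omega, hs⟩ : Staircase V s) ⟶ ⟨j, t - 1, by omega, by omega⟩)

end

end Staircase

/-! ### The nilpotent quiver algebra -/

/-- The defining relations of the nilpotent quiver algebra:
`a_{t+1} b(i_t) = b(j_{t-1}) a_t` for `a : i ⟶ j` and `1 < t < s`, and `a_2 b(i_1) = 0`. -/
inductive NilpotentRel (k : Type uk) (V : Type u) [Field k] [Quiver.{v} V] [Fintype V] (s : ℕ) :
    PathAlgebra k (Staircase V s) → PathAlgebra k (Staircase V s) → Prop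
  | mesh {i j : V} (a : i ⟶ j) (t : ℕ) (h1 : 1 < t) (hs : t < s) :
      NilpotentRel k V s
        (Staircase.diag k a (t + 1) (by omega) (by omega) *
          Staircase.vert k i t (by omega) (by omega))
        (Staircase.vert k j (t - 1) (by omega) (by omega) *
          Staircase.diag k a t (by omega) (by omega))
  | zero {i j : V} (a : i ⟶ j) (hs : 2 ≤ s) :
      NilpotentRel k V s
        (Staircase.diag k a 2 (by omega) (by omega) *
          Staircase.vert k i 1 (by omega) (by omega))
        0

/-- The nilpotent quiver algebra `N_s(Q)`: the quotient of the path algebra of the staircase quiver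
by the two-sided ideal generated by the relations. -/
abbrev NilpotentQuiverAlgebra (k : Type uk) (V : Type u) [Field k] [Quiver.{v} V] [Fintype V]
    (s : ℕ) : Type max uk u v :=
  RingQuot (NilpotentRel k V s)

/-! ### Global dimension -/

/-- The (left) global dimension of a ring: the supremum of the projective dimensions of all its left
modules (with the convention that the zero module has projective dimension `⊥`). The universe of the
modules is at least that of the ring, so there are enough projectives. -/
def globalDimension (R : Type u) [Ring R] : WithBot ℕ∞ :=
  ⨆ M : ModuleCat.{max u w} R, projectiveDimension M

end

universe w' w''

noncomputable section

/-! A module over `N_s(Q)` is a representation `M` of the staircase quiver satisfying the relations.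
The relations move every vertical arrow to the left of the diagonal ones, and `a_2 b(i_1) = 0` has
the same shape as the others once a zero level 0 is added.

Let `Ind L` be the representation induced from a representation `L` of the diagonal arrows alone. By
the normal form, its value at `i_t` is the sum of the components of `L` at `i` up to level `t`.
Vertical arrows act as inclusions and diagonal arrows by the shifted action of `L`. Thus `Ind` is
exact.

Restricting `M` to the diagonal arrows and inducing gives a short exact sequence `0 → Ind M' → Ind M
→ M → 0`, where `M'` is `M` with its levels raised by one (`syzygy_exact`). The right map sums
images under vertical arrows; the left one is "raise the level minus act by `b`", and telescoping
inverts it.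

The diagonal arrows carry no relations, so `L` has a standard resolution `0 → F₁ → F₀ → L → 0` by
free representations, split by an explicit homotopy (`freeSyzygy_split`, `split_freeSyzygy`). `Ind`
of a free representation is projective (`exists_section`). Hence `Ind L` has projective dimension at
most 1, and `M` at most 2. -/

/-! ### Representations and their morphisms -/

/-- A representation of the diagonal arrows of the staircase quiver, with levels in `ℕ`. -/
structure DiagRep (k : Type uk) [Field k] (V : Type u) [Quiver.{v} V] where
  obj : V → ℕ → Type w
  [addCommGroup : ∀ i t, AddCommGroup (obj i t)]
  [module : ∀ i t, Module k (obj i t)]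
  diag : ∀ {i j : V} (_ : i ⟶ j) (t : ℕ), obj i (t + 1) →ₗ[k] obj j t

attribute [instance] DiagRep.addCommGroup DiagRep.module

/-- A representation of the staircase quiver that satisfies the relations of the nilpotent quiver
algebra, with levels in `ℕ`, of which only `1, …, s` matter. As level `0` vanishes, both kinds of
relations take the same form. -/
structure NilRep (k : Type uk) [Field k] (V : Type u) [Quiver.{v} V] (s : ℕ) extends
    DiagRep.{w} k V where
  vert : ∀ (i : V) (t : ℕ), obj i t →ₗ[k] obj i (t + 1)
  subsingleton_zero : ∀ i, Subsingleton (obj i 0)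
  mesh : ∀ {i j : V} (a : i ⟶ j) (t : ℕ), t + 2 ≤ s → ∀ m : obj i (t + 1),
    diag a (t + 1) (vert i (t + 1) m) = vert j t (diag a t m)

variable {k : Type uk} [Field k] {V : Type u} [Quiver.{v} V] {s : ℕ}

/-- Morphisms of representations of the diagonal arrows. -/
structure DiagRep.Hom (L : DiagRep.{w} k V) (L' : DiagRep.{w'} k V) where
  app : ∀ i t, L.obj i t →ₗ[k] L'.obj i t
  comm : ∀ {i j : V} (a : i ⟶ j) (t : ℕ) (m : L.obj i (t + 1)),
    app j t (L.diag a t m) = L'.diag a t (app i (t + 1) m)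

/-- Morphisms of representations of the nilpotent quiver algebra. -/
structure NilRep.Hom (M : NilRep.{w} k V s) (M' : NilRep.{w'} k V s) where
  app : ∀ i t, M.obj i t →ₗ[k] M'.obj i t
  comm_diag : ∀ {i j : V} (a : i ⟶ j) (t : ℕ), 1 ≤ t → t + 1 ≤ s → ∀ m : M.obj i (t + 1),
    app j t (M.diag a t m) = M'.diag a t (app i (t + 1) m)
  comm_vert : ∀ (i : V) (t : ℕ), 1 ≤ t → t + 1 ≤ s → ∀ m : M.obj i t,
    app i (t + 1) (M.vert i t m) = M'.vert i t (app i t m)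

/-! ### The module of a representation -/

namespace NilRep

section Total

variable (M : NilRep.{w} k V s)

/-- The vertical maps, with propositional equalities between the indices. -/
def vertOfEq : ∀ {i j : V} {t r : ℕ}, i = j → r = t + 1 → (M.obj i t →ₗ[k] M.obj j r)
  | _, _, _, _, rfl, rfl => M.vert _ _

/-- The diagonal maps, with a propositional equality between the levels. -/
def diagOfEq : ∀ {i j : V} (_ : i ⟶ j) {t r : ℕ}, t = r + 1 → (M.obj i t →ₗ[k] M.obj j r)
  | _, _, a, _, _, rfl => M.diag a _

/-- The action of an arrow of the staircase quiver. -/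
def arrowMap {x y : Staircase V s} : (x ⟶ y) → (M.obj x.base x.level →ₗ[k] M.obj y.base y.level)
  | .vertical hb hl => M.vertOfEq hb hl
  | .diagonal a hl => M.diagOfEq a hl

/-- The action of a path of the staircase quiver. -/
def pathMap {x : Staircase V s} : ∀ {y : Staircase V s}, Quiver.Path x y →
    (M.obj x.base x.level →ₗ[k] M.obj y.base y.level)
  | _, .nil => LinearMap.id
  | _, .cons p a => M.arrowMap a ∘ₗ pathMap p

theorem pathMap_comp {x y : Staircase V s} (p : Quiver.Path x y) {z : Staircase V s}
    (q : Quiver.Path y z) (m : M.obj x.base x.level) :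
    M.pathMap (p.comp q) m = M.pathMap q (M.pathMap p m) := by
  induction q with
  | nil => rfl
  | cons q a ih => simp [pathMap, ih]

/-- The module of a representation, as a vector space. -/
def Total : Type max u w := ∀ x : Staircase V s, M.obj x.base x.level

instance : AddCommGroup M.Total :=
  inferInstanceAs (AddCommGroup (∀ x : Staircase V s, M.obj x.base x.level))

instance : Module k M.Total :=
  inferInstanceAs (Module k (∀ x : Staircase V s, M.obj x.base x.level))

open Classical in
/-- The inclusion of the component at a vertex. -/
def single (x : Staircase V s) : M.obj x.base x.level →ₗ[k] M.Total :=
  LinearMap.single k (fun x : Staircase V s => M.obj x.base x.level) x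

/-- The projection to the component at a vertex. -/
def proj (x : Staircase V s) : M.Total →ₗ[k] M.obj x.base x.level :=
  LinearMap.proj (R := k) (φ := fun x : Staircase V s => M.obj x.base x.level) x

@[simp] theorem proj_single (x : Staircase V s) (m : M.obj x.base x.level) :
    M.proj x (M.single x m) = m := by
  classical
  exact Pi.single_eq_same (M := fun x : Staircase V s => M.obj x.base x.level) x m

theorem proj_single_of_ne {x y : Staircase V s} (h : x ≠ y) (m : M.obj x.base x.level) :
    M.proj y (M.single x m) = 0 := by
  classical
  exact Pi.single_eq_of_ne (M := fun x : Staircase V s => M.obj x.base x.level) h.symm m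

@[ext] theorem total_ext {f g : M.Total} (h : ∀ x, M.proj x f = M.proj x g) : f = g :=
  funext h

variable [Fintype V]

theorem sum_single_proj (f : M.Total) : ∑ x, M.single x (M.proj x f) = f := by
  classical
  exact Finset.univ_sum_single (M := fun x : Staircase V s => M.obj x.base x.level) f

/-- The action of a path on the total space. -/
def pathEnd (p : QPath (Staircase V s)) : Module.End k M.Total :=
  M.single p.2.1 ∘ₗ M.pathMap p.2.2 ∘ₗ M.proj p.1

/-- The action of the path algebra on the total space, as a linear map. -/
def actionLin : PathAlgebra k (Staircase V s) →ₗ[k] Module.End k M.Total :=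
  (PathAlgebra.basis k (Staircase V s)).constr k M.pathEnd

theorem actionLin_ofPath {x y : Staircase V s} (p : Quiver.Path x y) (m : M.Total) :
    M.actionLin (PathAlgebra.ofPath k p) m = M.single y (M.pathMap p (M.proj x m)) := by
  have := (PathAlgebra.basis k (Staircase V s)).constr_basis k M.pathEnd ⟨x, y, p⟩
  exact LinearMap.congr_fun this m

/-- The action of the path algebra on the total space. -/
def action : PathAlgebra k (Staircase V s) →ₐ[k] Module.End k M.Total :=
  AlgHom.ofLinearMap M.actionLin
    (by
      ext1 m
      rw [PathAlgebra.one_def, map_sum, LinearMap.sum_apply]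
      simp only [PathAlgebra.idem, actionLin_ofPath, pathMap]
      exact M.sum_single_proj m)
    (by
      intro a b
      have key : (LinearMap.mul k (PathAlgebra k (Staircase V s))).compr₂ M.actionLin =
          (LinearMap.mul k (Module.End k M.Total)).compl₁₂ M.actionLin M.actionLin := by
        refine (PathAlgebra.basis k _).ext fun q => (PathAlgebra.basis k _).ext fun p => ?_
        obtain ⟨q1, q2, q⟩ := q
        obtain ⟨p1, p2, p⟩ := p
        ext1 m
        simp only [PathAlgebra.basis_apply, LinearMap.compr₂_apply, LinearMap.compl₁₂_apply,
          LinearMap.mul_apply', Module.End.mul_apply, actionLin_ofPath]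
        by_cases h : p2 = q1
        · subst h
          rw [PathAlgebra.ofPath_mul_ofPath, actionLin_ofPath, proj_single, pathMap_comp]
        · rw [PathAlgebra.ofPath_mul_ofPath_of_ne _ _ _ h, proj_single_of_ne _ h]
          simp
      exact LinearMap.congr_fun (LinearMap.congr_fun key a) b)

theorem action_ofPath {x y : Staircase V s} (p : Quiver.Path x y) (m : M.Total) :
    M.action (PathAlgebra.ofPath k p) m = M.single y (M.pathMap p (M.proj x m)) :=
  M.actionLin_ofPath p m

theorem action_ofArrow {x y : Staircase V s} (a : x ⟶ y) (m : M.Total) :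
    M.action (PathAlgebra.ofArrow k a) m = M.single y (M.arrowMap a (M.proj x m)) :=
  M.actionLin_ofPath _ m

theorem action_diag {i j : V} (a : i ⟶ j) (t : ℕ) (h1 : 1 ≤ t) (hs : t + 1 ≤ s) (m : M.Total) :
    M.action (Staircase.diag k a (t + 1) (by omega) hs) m =
      M.single ⟨j, t, h1, by omega⟩ (M.diag a t (M.proj ⟨i, t + 1, by omega, hs⟩ m)) := by
  rw [Staircase.diag, action_ofArrow]
  rfl

theorem action_vert (i : V) (t : ℕ) (h1 : 1 ≤ t) (hs : t < s) (m : M.Total) :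
    M.action (Staircase.vert k i t h1 hs) m =
      M.single ⟨i, t + 1, by omega, hs⟩ (M.vert i t (M.proj ⟨i, t, h1, hs.le⟩ m)) := by
  rw [Staircase.vert, action_ofArrow]
  rfl

theorem action_rel {a b : PathAlgebra k (Staircase V s)} (h : NilpotentRel k V s a b) :
    M.action a = M.action b := by
  induction h with
  | mesh a t h1 hs =>
    obtain ⟨t, rfl⟩ : ∃ r, t = r + 1 := ⟨t - 1, by omega⟩
    ext1 m
    rw [map_mul, map_mul, Module.End.mul_apply, Module.End.mul_apply,
      M.action_vert _ _ (by omega) hs, M.action_diag a (t + 1) (by omega) (by omega), proj_single,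
      M.action_diag a t (by omega) (by omega)]
    -- The relation has level `t + 1 - 1` here, equal to `t` only by unfolding, so the vertical
    -- action enters through `Eq.trans` and not `rw`.
    refine Eq.trans ?_ (M.action_vert _ t (by omega) (by omega) _).symm
    rw [proj_single, M.mesh a t (by omega)]
  | zero a hs =>
    ext1 m
    -- The zero relation is the mesh identity at `t = 0`, whose other side factors through the zero
    -- space at level 0.
    rw [map_mul, map_zero, Module.End.mul_apply, M.action_vert _ 1 le_rfl hs,
      M.action_diag a 1 le_rfl hs, proj_single, M.mesh a 0 hs]
    have := M.subsingleton_zero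
    rw [Subsingleton.elim (M.diag a 0 _) 0]
    simp

instance : Module (NilpotentQuiverAlgebra k V s) M.Total :=
  Module.compHom M.Total
    (RingQuot.liftAlgHom k ⟨M.action, fun _ _ h => M.action_rel h⟩ :
      NilpotentQuiverAlgebra k V s →ₐ[k] Module.End k M.Total).toRingHom

theorem mk_smul (a : PathAlgebra k (Staircase V s)) (m : M.Total) :
    RingQuot.mkAlgHom k (NilpotentRel k V s) a • m = M.action a m :=
  LinearMap.congr_fun (RingQuot.liftAlgHom_mkAlgHom_apply k M.action
    (fun _ _ h => M.action_rel h) a) m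

end Total

end NilRep

/-! ### Linearity over the algebra, tested on generators -/

section

variable [Fintype V]

theorem PathAlgebra.idem_mul_ofArrow {W : Type u} [Quiver.{v} W] [Fintype W] {x y : W}
    (a : x ⟶ y) : PathAlgebra.idem k y * PathAlgebra.ofArrow k a = PathAlgebra.ofArrow k a :=
  PathAlgebra.ofPath_mul_ofPath k _ _

theorem PathAlgebra.ofPath_mul_idem_of_ne {W : Type u} [Quiver.{v} W] [Fintype W] {x y z : W}
    (p : Quiver.Path x y) (h : z ≠ x) : PathAlgebra.ofPath k p * PathAlgebra.idem k z = 0 :=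
  PathAlgebra.ofPath_mul_ofPath_of_ne k _ _ h

/-- Paths span the path algebra, and each is a product of arrows and a trivial path. -/
theorem Staircase.pathAlgebra_induction {P : PathAlgebra k (Staircase V s) → Prop}
    (zero : P 0) (idem : ∀ x, P (PathAlgebra.idem k x))
    (vert : ∀ i t h1 hs, P (Staircase.vert k i t h1 hs))
    (diag : ∀ {i j : V} (a : i ⟶ j) (t : ℕ) (h1 : 1 ≤ t) (hs : t + 1 ≤ s),
      P (Staircase.diag k a (t + 1) (by omega) hs))
    (mul : ∀ a b, P a → P b → P (a * b)) (add : ∀ a b, P a → P b → P (a + b))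
    (smul : ∀ (c : k) a, P a → P (c • a)) (x : PathAlgebra k (Staircase V s)) : P x := by
  have harr : ∀ {x y : Staircase V s} (a : x ⟶ y), P (PathAlgebra.ofArrow k a) := by
    intro x y a
    obtain ⟨i, t, ht, hts⟩ := x
    obtain ⟨j, r, hr, hrs⟩ := y
    change Staircase.Arrow _ _ at a
    cases a with
    | vertical hb hl =>
      dsimp only at hb hl
      subst hb hl
      exact vert i t ht hrs
    | diagonal a hl =>
      dsimp only at hl
      subst hl
      exact diag a r hr hts
  have hpath : ∀ {x y : Staircase V s} (p : Quiver.Path x y), P (PathAlgebra.ofPath k p) := by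
    intro x y p
    induction p with
    | nil => exact idem _
    | cons p a ih =>
      have := mul _ _ (harr a) ih
      rwa [PathAlgebra.ofArrow, PathAlgebra.ofPath_mul_ofPath] at this
  have hx : x ∈ Submodule.span k (Set.range (PathAlgebra.basis k (Staircase V s))) := by
    rw [Module.Basis.span_eq]; trivial
  induction hx using Submodule.span_induction with
  | mem x h => obtain ⟨p, rfl⟩ := h; exact hpath p.2.2
  | zero => exact zero
  | add x y _ _ hx hy => exact add _ _ hx hy
  | smul c x _ hx => exact smul c _ hx

namespace NilRep

variable (k V s) in
/-- The projection of the path algebra to the nilpotent quiver algebra. -/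
abbrev ofPathAlgebra : PathAlgebra k (Staircase V s) →ₐ[k] NilpotentQuiverAlgebra k V s :=
  RingQuot.mkAlgHom k (NilpotentRel k V s)

instance (M : NilRep.{w} k V s) : IsScalarTower k (NilpotentQuiverAlgebra k V s) M.Total where
  smul_assoc c n m := by
    obtain ⟨a, rfl⟩ := RingQuot.mkAlgHom_surjective k (NilpotentRel k V s) n
    rw [← map_smul, mk_smul, mk_smul, map_smul, LinearMap.smul_apply]

section Linear

variable {A : Type*} {B : Type*} [AddCommGroup A] [AddCommGroup B] [Module k A] [Module k B]
  [Module (NilpotentQuiverAlgebra k V s) A] [Module (NilpotentQuiverAlgebra k V s) B]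
  [IsScalarTower k (NilpotentQuiverAlgebra k V s) A]
  [IsScalarTower k (NilpotentQuiverAlgebra k V s) B]

/-- A `k`-linear map that commutes with vertices and arrows is linear over the nilpotent quiver
algebra. -/
def linearOfGenerators (f : A →ₗ[k] B)
    (idem : ∀ x m, f (ofPathAlgebra k V s (PathAlgebra.idem k x) • m) = ofPathAlgebra k V s (PathAlgebra.idem k x) • f m)
    (vert : ∀ i t h1 hs m, f (ofPathAlgebra k V s (Staircase.vert k i t h1 hs) • m) =
      ofPathAlgebra k V s (Staircase.vert k i t h1 hs) • f m)
    (diag : ∀ {i j : V} (a : i ⟶ j) (t : ℕ) (h1 : 1 ≤ t) (hs : t + 1 ≤ s) (m : A),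
      f (ofPathAlgebra k V s (Staircase.diag k a (t + 1) (by omega) hs) • m) =
        ofPathAlgebra k V s (Staircase.diag k a (t + 1) (by omega) hs) • f m) :
    A →ₗ[NilpotentQuiverAlgebra k V s] B where
  toFun := f
  map_add' := map_add f
  map_smul' n m := by
    obtain ⟨n, rfl⟩ := RingQuot.mkAlgHom_surjective k (NilpotentRel k V s) n
    simp only [RingHom.id_apply]
    revert m
    induction n using Staircase.pathAlgebra_induction with
    | zero => simp
    | idem x => exact idem x
    | vert i t h1 hs => exact vert i t h1 hs
    | diag a t h1 hs => exact diag a t h1 hs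
    | mul a b ha hb => intro m; rw [map_mul, mul_smul, mul_smul, ha, hb]
    | add a b ha hb => intro m; rw [map_add, add_smul, add_smul, map_add, ha, hb]
    | smul c a ha => intro m; rw [map_smul (RingQuot.mkAlgHom k (NilpotentRel k V s)) c a, smul_assoc, smul_assoc,
        f.map_smul, ha]

end Linear

theorem mk_idem_smul (M : NilRep.{w} k V s) (x : Staircase V s) (m : M.Total) :
    ofPathAlgebra k V s (PathAlgebra.idem k x) • m = M.single x (M.proj x m) :=
  (M.mk_smul _ m).trans (M.action_ofPath _ m)

theorem mk_diag_smul (M : NilRep.{w} k V s) {i j : V} (a : i ⟶ j) (t : ℕ) (h1 : 1 ≤ t)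
    (hs : t + 1 ≤ s) (m : M.Total) :
    ofPathAlgebra k V s (Staircase.diag k a (t + 1) (by omega) hs) • m =
      M.single ⟨j, t, h1, by omega⟩ (M.diag a t (M.proj ⟨i, t + 1, by omega, hs⟩ m)) :=
  (M.mk_smul _ m).trans (M.action_diag a t h1 hs m)

theorem mk_vert_smul (M : NilRep.{w} k V s) (i : V) (t : ℕ) (h1 : 1 ≤ t) (hs : t < s)
    (m : M.Total) :
    ofPathAlgebra k V s (Staircase.vert k i t h1 hs) • m =
      M.single ⟨i, t + 1, by omega, hs⟩ (M.vert i t (M.proj ⟨i, t, h1, hs.le⟩ m)) :=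
  (M.mk_smul _ m).trans (M.action_vert i t h1 hs m)

namespace Hom

variable {M : NilRep.{w} k V s} {M' : NilRep.{w'} k V s} (φ : Hom M M')

/-- The `k`-linear map between the total spaces. -/
def totalLin : M.Total →ₗ[k] M'.Total where
  toFun m x := φ.app x.base x.level (M.proj x m)
  map_add' m m' := by ext x; exact (φ.app x.base x.level).map_add _ _
  map_smul' c m := by ext x; exact (φ.app x.base x.level).map_smul _ _

omit [Fintype V] in
@[simp] theorem proj_totalLin (m : M.Total) (x : Staircase V s) :
    M'.proj x (φ.totalLin m) = φ.app x.base x.level (M.proj x m) := rfl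

omit [Fintype V] in
theorem totalLin_single (x : Staircase V s) (m : M.obj x.base x.level) :
    φ.totalLin (M.single x m) = M'.single x (φ.app x.base x.level m) := by
  ext y
  by_cases h : x = y
  · subst h; simp
  · simp [proj_single_of_ne _ h]

/-- The linear map between the modules of two representations. -/
def total : M.Total →ₗ[NilpotentQuiverAlgebra k V s] M'.Total :=
  linearOfGenerators φ.totalLin
    (fun x m => by simp only [mk_idem_smul, totalLin_single, proj_totalLin])
    (fun i t h1 hs m => by
      rw [mk_vert_smul, mk_vert_smul]
      exact (φ.totalLin_single _ _).trans (congrArg _ (φ.comm_vert i t h1 hs _)))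
    (fun a t h1 hs m => by
      rw [mk_diag_smul _ a t h1 hs, mk_diag_smul _ a t h1 hs]
      exact (φ.totalLin_single _ _).trans (congrArg _ (φ.comm_diag a t h1 hs _)))

theorem total_single (x : Staircase V s) (m : M.obj x.base x.level) :
    φ.total (M.single x m) = M'.single x (φ.app x.base x.level m) :=
  φ.totalLin_single x m

theorem total_injective (h : ∀ i t, 1 ≤ t → t ≤ s → Function.Injective (φ.app i t)) :
    Function.Injective φ.total := fun m m' e => by
  ext x
  exact h _ _ x.one_le x.le_s (congrArg (M'.proj x) e)

theorem total_surjective (h : ∀ i t, 1 ≤ t → t ≤ s → Function.Surjective (φ.app i t)) :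
    Function.Surjective φ.total := fun m => by
  choose f hf using fun x : Staircase V s => h _ _ x.one_le x.le_s (M'.proj x m)
  exact ⟨f, M'.total_ext hf⟩

theorem total_exact {M'' : NilRep.{w''} k V s} (ψ : Hom M' M'')
    (h : ∀ i t, 1 ≤ t → t ≤ s → Function.Exact (φ.app i t) (ψ.app i t)) :
    Function.Exact φ.total ψ.total := fun m => by
  constructor
  · intro e
    choose f hf using fun x : Staircase V s =>
      (h _ _ x.one_le x.le_s (M'.proj x m)).1 (congrArg (M''.proj x) e)
    exact ⟨f, M'.total_ext hf⟩
  · rintro ⟨m, rfl⟩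
    ext x
    exact (h _ _ x.one_le x.le_s _).2 ⟨_, rfl⟩

end Hom

end NilRep

end

/-! ### From modules to representations -/

section

variable [Fintype V]

namespace NilpotentQuiverAlgebra

open NilRep

variable (k s) in
/-- The idempotent of a vertex, zero if the level is out of range. -/
def vertexElt (i : V) (t : ℕ) : NilpotentQuiverAlgebra k V s :=
  if h : 1 ≤ t ∧ t ≤ s then ofPathAlgebra k V s (PathAlgebra.idem k ⟨i, t, h.1, h.2⟩) else 0

variable (k s) in
/-- The vertical arrow from level `t` to `t + 1`, zero if a level is out of range. -/
def vertElt (i : V) (t : ℕ) : NilpotentQuiverAlgebra k V s :=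
  if h : 1 ≤ t ∧ t < s then ofPathAlgebra k V s (Staircase.vert k i t h.1 h.2) else 0

variable (k s) in
/-- The diagonal arrow from level `t + 1` to `t`, zero if a level is out of range. -/
def diagElt {i j : V} (a : i ⟶ j) (t : ℕ) : NilpotentQuiverAlgebra k V s :=
  if h : 1 ≤ t ∧ t + 1 ≤ s then ofPathAlgebra k V s (Staircase.diag k a (t + 1) (by omega) h.2) else 0

theorem vertexElt_eq (x : Staircase V s) :
    vertexElt k s x.base x.level = ofPathAlgebra k V s (PathAlgebra.idem k x) :=
  dif_pos ⟨x.one_le, x.le_s⟩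

theorem vertexElt_mul_self (i : V) (t : ℕ) :
    vertexElt k s i t * vertexElt k s i t = vertexElt k s i t := by
  unfold vertexElt
  split_ifs with h
  · rw [← map_mul]
    exact congrArg _ (PathAlgebra.ofPath_mul_ofPath k _ _)
  · simp

theorem vertexElt_mul_vertElt (i : V) (t : ℕ) :
    vertexElt k s i (t + 1) * vertElt k s i t = vertElt k s i t := by
  unfold vertElt
  split_ifs with h
  · rw [vertexElt, dif_pos ⟨by omega, h.2⟩, ← map_mul]
    exact congrArg _ (PathAlgebra.idem_mul_ofArrow _)
  · simp

theorem vertexElt_mul_diagElt {i j : V} (a : i ⟶ j) (t : ℕ) :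
    vertexElt k s j t * diagElt k s a t = diagElt k s a t := by
  unfold diagElt
  split_ifs with h
  · rw [vertexElt, dif_pos ⟨h.1, by omega⟩, ← map_mul]
    exact congrArg _ (PathAlgebra.idem_mul_ofArrow _)
  · simp

/-- Extension by zero merges the two kinds of relations: for `t = 0` the right side is out of range,
which leaves `a_2 b(i_1) = 0`. -/
theorem diagElt_mul_vertElt {i j : V} (a : i ⟶ j) (t : ℕ) (ht : t + 2 ≤ s) :
    diagElt k s a (t + 1) * vertElt k s i (t + 1) = vertElt k s j t * diagElt k s a t := by
  rw [diagElt, dif_pos ⟨by omega, ht⟩, vertElt, dif_pos ⟨by omega, by omega⟩, ← map_mul]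
  rcases Nat.eq_zero_or_pos t with rfl | h
  · rw [vertElt, dif_neg (by omega), zero_mul]
    exact (RingQuot.mkAlgHom_rel k (NilpotentRel.zero a ht)).trans (map_zero _)
  · rw [vertElt, dif_pos ⟨h, by omega⟩, diagElt, dif_pos ⟨h, by omega⟩, ← map_mul]
    exact RingQuot.mkAlgHom_rel k (NilpotentRel.mesh a (t + 1) (by omega) ht)

end NilpotentQuiverAlgebra

namespace NilRep

open NilpotentQuiverAlgebra

variable (E : Type w) [AddCommGroup E] [Module k E] [Module (NilpotentQuiverAlgebra k V s) E]
  [IsScalarTower k (NilpotentQuiverAlgebra k V s) E]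

variable (k s) in
/-- The component of a module at a vertex. -/
def component (i : V) (t : ℕ) : Submodule k E where
  carrier := {m | vertexElt k s i t • m = m}
  add_mem' {a b} ha hb := by
    simp only [Set.mem_ofPred_eq] at *
    rw [smul_add, ha, hb]
  zero_mem' := smul_zero _
  smul_mem' c m hm := by
    simp only [Set.mem_ofPred_eq] at *
    rw [← algebraMap_smul (NilpotentQuiverAlgebra k V s) c m, ← mul_smul,
      ← Algebra.commutes, mul_smul, hm]

variable (k V s) in
/-- Multiplication by a ring element, as a map between vector spaces. -/
def mulLeft (n : NilpotentQuiverAlgebra k V s) : E →ₗ[k] E where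
  toFun m := n • m
  map_add' := smul_add n
  map_smul' c m := by
    rw [RingHom.id_apply, ← algebraMap_smul (NilpotentQuiverAlgebra k V s) c m, ← mul_smul,
      ← Algebra.commutes, mul_smul, algebraMap_smul]

variable (k V s) in
/-- The representation given by a module over the nilpotent quiver algebra. -/
def ofModule : NilRep.{w} k V s where
  obj i t := component k s E i t
  diag {i j} a t := ((mulLeft k V s E (diagElt k s a t)).comp (Submodule.subtype _)).codRestrict _
    fun m => by
      change vertexElt k s j t • (diagElt k s a t • (m : E)) = diagElt k s a t • (m : E)
      rw [← mul_smul, vertexElt_mul_diagElt]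
  vert i t := ((mulLeft k V s E (vertElt k s i t)).comp (Submodule.subtype _)).codRestrict _
    fun m => by
      change vertexElt k s i (t + 1) • (vertElt k s i t • (m : E)) = vertElt k s i t • (m : E)
      rw [← mul_smul, vertexElt_mul_vertElt]
  subsingleton_zero i := by
    have h : ∀ m : component k s E i 0, m = 0 := fun m => by
      apply Subtype.ext
      have := m.2
      change vertexElt k s i 0 • (m : E) = m at this
      rw [← this, vertexElt, dif_neg (by omega), zero_smul]
      rfl
    exact ⟨fun a b => (h a).trans (h b).symm⟩
  mesh {i j} a t ht m := by
    apply Subtype.ext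
    change diagElt k s a (t + 1) • (vertElt k s i (t + 1) • (m : E)) =
      vertElt k s j t • (diagElt k s a t • (m : E))
    rw [← mul_smul, ← mul_smul, diagElt_mul_vertElt a t ht]

variable (k V s) in
/-- The inclusion of a component into the module. -/
def val (i : V) (t : ℕ) : (ofModule k V s E).obj i t →ₗ[k] E :=
  (component k s E i t).subtype

variable {E}

theorem val_injective (i : V) (t : ℕ) : Function.Injective (val k V s E i t) :=
  Subtype.val_injective

theorem vertexElt_smul_val (i : V) (t : ℕ) (m : (ofModule k V s E).obj i t) :
    vertexElt k s i t • val k V s E i t m = val k V s E i t m :=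
  Subtype.prop (p := fun m : E => vertexElt k s i t • m = m) m

variable (k V s E) in
/-- The projection of a module to a component. -/
def toComponent (i : V) (t : ℕ) : E →ₗ[k] (ofModule k V s E).obj i t :=
  (mulLeft k V s E (vertexElt k s i t)).codRestrict (component k s E i t) fun m => by
    change vertexElt k s i t • (vertexElt k s i t • m) = vertexElt k s i t • m
    rw [← mul_smul, vertexElt_mul_self]

theorem val_toComponent (i : V) (t : ℕ) (m : E) :
    val k V s E i t (toComponent k V s E i t m) = vertexElt k s i t • m := rfl

theorem val_diag {i j : V} (a : i ⟶ j) (t : ℕ) (h1 : 1 ≤ t) (hs : t + 1 ≤ s)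
    (m : (ofModule k V s E).obj i (t + 1)) :
    val k V s E j t ((ofModule k V s E).diag a t m) =
      ofPathAlgebra k V s (Staircase.diag k a (t + 1) (by omega) hs) •
        val k V s E i (t + 1) m := by
  change diagElt k s a t • val k V s E i (t + 1) m = _
  rw [diagElt, dif_pos ⟨h1, hs⟩]

theorem val_vert (i : V) (t : ℕ) (h1 : 1 ≤ t) (hs : t < s) (m : (ofModule k V s E).obj i t) :
    val k V s E i (t + 1) ((ofModule k V s E).vert i t m) =
      ofPathAlgebra k V s (Staircase.vert k i t h1 hs) • val k V s E i t m := by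
  change vertElt k s i t • val k V s E i t m = _
  rw [vertElt, dif_pos ⟨h1, hs⟩]

theorem idem_smul_val (x : Staircase V s) (m : (ofModule k V s E).obj x.base x.level) :
    ofPathAlgebra k V s (PathAlgebra.idem k x) • val k V s E _ _ m = val k V s E _ _ m := by
  rw [← vertexElt_eq, vertexElt_smul_val]

variable (k V s E) in
/-- The sum of the components of an element of the total space. -/
def gatherLin : (ofModule k V s E).Total →ₗ[k] E :=
  ∑ x : Staircase V s, val k V s E x.base x.level ∘ₗ (ofModule k V s E).proj x

theorem gatherLin_single (x : Staircase V s) (m : (ofModule k V s E).obj x.base x.level) :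
    gatherLin k V s E ((ofModule k V s E).single x m) = val k V s E _ _ m := by
  rw [gatherLin, LinearMap.sum_apply, Finset.sum_eq_single x]
  · rw [LinearMap.comp_apply, proj_single]
  · intro y _ hy
    rw [LinearMap.comp_apply, proj_single_of_ne _ hy.symm, map_zero]
  · simp

/-- A path annihilates the components at all vertices other than its start. -/
theorem ofPath_smul_gatherLin {x y : Staircase V s} (p : Quiver.Path x y)
    (m : (ofModule k V s E).Total) :
    ofPathAlgebra k V s (PathAlgebra.ofPath k p) • gatherLin k V s E m =
      ofPathAlgebra k V s (PathAlgebra.ofPath k p) •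
        val k V s E _ _ ((ofModule k V s E).proj x m) := by
  rw [gatherLin, LinearMap.sum_apply, Finset.smul_sum, Finset.sum_eq_single x]
  · rfl
  · intro z _ hz
    rw [LinearMap.comp_apply, ← idem_smul_val z, ← mul_smul, ← map_mul,
      PathAlgebra.ofPath_mul_idem_of_ne p hz, map_zero, zero_smul]
  · simp

variable (k V s E) in
/-- The sum of the components of an element of the total space, as a linear map over the nilpotent
quiver algebra. -/
def gather : (ofModule k V s E).Total →ₗ[NilpotentQuiverAlgebra k V s] E :=
  linearOfGenerators (gatherLin k V s E)
    (fun x m => by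
      rw [mk_idem_smul, gatherLin_single]
      exact (idem_smul_val x _).symm.trans (ofPath_smul_gatherLin _ m).symm)
    (fun i t h1 hs m => by
      rw [mk_vert_smul]
      exact (gatherLin_single _ _).trans
        ((val_vert i t h1 hs _).trans (ofPath_smul_gatherLin _ m).symm))
    (fun a t h1 hs m => by
      rw [mk_diag_smul _ a t h1 hs]
      exact (gatherLin_single _ _).trans
        ((val_diag a t h1 hs _).trans (ofPath_smul_gatherLin _ m).symm))

theorem gather_single (x : Staircase V s) (m : (ofModule k V s E).obj x.base x.level) :
    gather k V s E ((ofModule k V s E).single x m) = val k V s E _ _ m :=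
  gatherLin_single x m

/-- Peirce decomposition: the vertex idempotents are orthogonal, so multiplying by one isolates its
component, and they sum to 1, so the components exhaust the module. -/
theorem gather_bijective : Function.Bijective (gather k V s E) := by
  constructor
  · rw [injective_iff_map_eq_zero]
    intro m hm
    ext x
    have h : ofPathAlgebra k V s (PathAlgebra.idem k x) • gatherLin k V s E m = 0 := by
      rw [show gatherLin k V s E m = 0 from hm, smul_zero]
    have h2 := (ofPath_smul_gatherLin (Quiver.Path.nil : Quiver.Path x x) m).symm.trans h
    apply val_injective
    rw [map_zero, map_zero]
    exact (idem_smul_val x _).symm.trans h2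
  · intro m
    refine ⟨∑ x, (ofModule k V s E).single x (toComponent k V s E x.base x.level m), ?_⟩
    rw [map_sum]
    simp only [gather_single, val_toComponent, vertexElt_eq]
    rw [← Finset.sum_smul, ← map_sum, ← PathAlgebra.one_def, map_one, one_smul]

variable (k V s E) in
/-- A module over the nilpotent quiver algebra is the module of its representation. -/
def gatherEquiv : (ofModule k V s E).Total ≃ₗ[NilpotentQuiverAlgebra k V s] E :=
  LinearEquiv.ofBijective (gather k V s E) gather_bijective

end NilRep

end

/-! ### Induction from the diagonal arrows -/

namespace DiagRep

variable (L : DiagRep.{w} k V)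

/-- The families of vectors that are supported in levels below `t`. -/
def below (i : V) (t : ℕ) : Submodule k (∀ r, L.obj i r) where
  carrier := {f | ∀ r, t ≤ r → f r = 0}
  add_mem' hf hg r hr := by simp [hf r hr, hg r hr]
  zero_mem' _ _ := rfl
  smul_mem' c f hf r hr := by simp [hf r hr]

/-- The diagonal arrows acting on families of vectors. -/
def shiftDiag {i j : V} (a : i ⟶ j) : (∀ r, L.obj i r) →ₗ[k] ∀ r, L.obj j r where
  toFun f r := L.diag a r (f (r + 1))
  map_add' _ _ := funext fun _ => map_add _ _ _
  map_smul' _ _ := funext fun _ => map_smul _ _ _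

/-- The representation of the nilpotent quiver algebra induced from a representation of the diagonal
arrows. The level `r` of the given representation becomes the level `r + 1`. -/
def induced (s : ℕ) : NilRep.{w} k V s where
  obj i t := L.below i t
  diag a t := (L.shiftDiag a).restrict fun f hf r hr => by
    change L.diag a r (f (r + 1)) = 0
    rw [hf (r + 1) (by omega), map_zero]
  vert i t := Submodule.inclusion fun f hf r hr => hf r (by omega)
  subsingleton_zero i :=
    ⟨fun f g => Subtype.ext (funext fun r =>
      (f.2 r (Nat.zero_le r)).trans (g.2 r (Nat.zero_le r)).symm)⟩
  mesh a t _ m := rfl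

/-- A representation with all levels lowered by one. -/
def lower : DiagRep.{w} k V where
  obj i t := L.obj i (t + 1)
  diag a t := L.diag a (t + 1)

variable {L} {L' : DiagRep.{w'} k V} {L'' : DiagRep.{w''} k V}

namespace Hom

/-- A morphism acting on families of vectors. -/
def family (φ : Hom L L') (i : V) : (∀ r, L.obj i r) →ₗ[k] ∀ r, L'.obj i r where
  toFun f r := φ.app i r (f r)
  map_add' _ _ := funext fun _ => map_add _ _ _
  map_smul' _ _ := funext fun _ => map_smul _ _ _

/-- Induction is a functor. -/
def induced (φ : Hom L L') (s : ℕ) : NilRep.Hom (L.induced s) (L'.induced s) where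
  app i t := (φ.family i).restrict fun f hf r hr => by
    change φ.app i r (f r) = 0
    rw [hf r hr, map_zero]
  comm_diag a t _ _ m := Subtype.ext (funext fun r => φ.comm a r (m.1 (r + 1)))
  comm_vert i t _ _ m := rfl

theorem induced_injective (φ : Hom L L') (h : ∀ i t, t < s → Function.Injective (φ.app i t))
    (i : V) (t : ℕ) (ht : t ≤ s) : Function.Injective ((φ.induced s).app i t) := fun f g e => by
  refine Subtype.ext (funext fun r => ?_)
  by_cases hr : r < t
  · exact h i r (by omega) (congrFun (congrArg Subtype.val e) r)
  · exact (f.2 r (by omega)).trans (g.2 r (by omega)).symm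

/-- Preimages are chosen level by level; extending them by zero keeps the family supported below
`t`. -/
theorem exists_induced_eq (φ : Hom L L') {i : V} {t : ℕ} (g : L'.below i t)
    (h : ∀ r, r < t → ∃ m, φ.app i r m = g.1 r) : ∃ f, (φ.induced s).app i t f = g := by
  choose f hf using h
  refine ⟨⟨fun r => if h : r < t then f r h else 0, fun r hr => dif_neg (by omega)⟩,
    Subtype.ext (funext fun r => ?_)⟩
  change φ.app i r (dite _ _ _) = _
  split_ifs with hr
  · exact hf r hr
  · rw [map_zero]
    exact (g.2 r (by omega)).symm

theorem induced_surjective (φ : Hom L L') (h : ∀ i t, t < s → Function.Surjective (φ.app i t))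
    (i : V) (t : ℕ) (ht : t ≤ s) : Function.Surjective ((φ.induced s).app i t) := fun g =>
  φ.exists_induced_eq g fun r hr => h i r (by omega) _

/-- Exactness of induction: the value at `i_t` is a product of the levels below `t`, on which the
morphisms act separately. Since `t ≤ s`, only levels below `s` matter. -/
theorem induced_exact (φ : Hom L L') (ψ : Hom L' L'')
    (h : ∀ i t, t < s → Function.Exact (φ.app i t) (ψ.app i t))
    (i : V) (t : ℕ) (ht : t ≤ s) :
    Function.Exact ((φ.induced s).app i t) ((ψ.induced s).app i t) := fun g => by
  constructor
  · intro e
    exact φ.exists_induced_eq g fun r hr =>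
      (h i r (by omega) _).1 (congrFun (congrArg Subtype.val e) r)
  · rintro ⟨f, rfl⟩
    refine Subtype.ext (funext fun r => ?_)
    by_cases hr : r < t
    · exact (h i r (by omega) _).2 ⟨f.1 r, rfl⟩
    · change ψ.app i r (φ.app i r (f.1 r)) = 0
      rw [f.2 r (by omega), map_zero, map_zero]

end Hom

end DiagRep

/-! ### The resolution of a representation by induced ones -/

namespace NilRep

variable (M : NilRep.{w} k V s)

/-- The sum of the images of the vectors of levels `1, …, t` under the vertical arrows. -/
def counitAux (i : V) : ∀ t : ℕ, (∀ r, M.obj i (r + 1)) →ₗ[k] M.obj i t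
  | 0 => 0
  | t + 1 => M.vert i t ∘ₗ counitAux i t + LinearMap.proj t

theorem counitAux_succ (i : V) (t : ℕ) (f : ∀ r, M.obj i (r + 1)) :
    M.counitAux i (t + 1) f = M.vert i t (M.counitAux i t f) + f t := rfl

theorem counitAux_succ_of_eq_zero (i : V) (t : ℕ) (f : ∀ r, M.obj i (r + 1)) (h : f t = 0) :
    M.counitAux i (t + 1) f = M.vert i t (M.counitAux i t f) := by
  rw [counitAux_succ, h, add_zero]

/-- The mesh relations carry a diagonal arrow past the vertical ones; a vector of level 1 is sent to
level 0 and disappears. This makes the counit a morphism. -/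
theorem diag_counitAux {i j : V} (a : i ⟶ j) (t : ℕ) (ht : t + 1 ≤ s)
    (f : ∀ r, M.obj i (r + 1)) :
    M.diag a t (M.counitAux i (t + 1) f) = M.counitAux j t (M.lower.shiftDiag a f) := by
  induction t with
  | zero =>
    have := M.subsingleton_zero j
    exact Subsingleton.elim _ _
  | succ t ih =>
    rw [counitAux_succ, map_add, M.mesh a t (by omega), ih (by omega)]
    exact (M.counitAux_succ j t _).symm

/-- The canonical map from the representation induced from the diagonal arrows. -/
def counit : Hom (M.lower.induced s) M where
  app i t := M.counitAux i t ∘ₗ (M.lower.below i t).subtype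
  comm_diag a t _ hs f := (M.diag_counitAux a t hs f.1).symm
  comm_vert i t _ _ f := M.counitAux_succ_of_eq_zero i t f.1 (f.2 t le_rfl)

/-- The difference between raising the level and acting by the vertical arrows. -/
def syzygyAux (i : V) : (∀ r, M.obj i r) →ₗ[k] ∀ r, M.obj i (r + 1) where
  toFun g r := g (r + 1) - M.vert i r (g r)
  map_add' g g' := funext fun r => by
    change g (r + 1) + g' (r + 1) - M.vert i r (g r + g' r) = g (r + 1) - M.vert i r (g r) +
      (g' (r + 1) - M.vert i r (g' r))
    rw [map_add]; abel
  map_smul' c g := funext fun r => by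
    change c • g (r + 1) - M.vert i r (c • g r) = c • (g (r + 1) - M.vert i r (g r))
    rw [map_smul, smul_sub]

/-- The sum telescopes, and its initial term vanishes because level 0 is zero. -/
theorem counitAux_syzygyAux (i : V) (t : ℕ) (g : ∀ r, M.obj i r) :
    M.counitAux i t (M.syzygyAux i g) = g t := by
  induction t with
  | zero =>
    have := M.subsingleton_zero i
    exact Subsingleton.elim _ _
  | succ t ih =>
    rw [counitAux_succ, ih]
    exact add_sub_cancel _ _

/-- The family of all partial sums is thus a two-sided inverse of the syzygy map on unrestricted
families; exactness only has to keep track of supports. -/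
theorem syzygyAux_counitAux (i : V) (f : ∀ r, M.obj i (r + 1)) :
    M.syzygyAux i (fun r => M.counitAux i r f) = f := funext fun r => by
  change M.counitAux i (r + 1) f - M.vert i r (M.counitAux i r f) = f r
  rw [counitAux_succ, add_sub_cancel_left]

/-- The kernel of the counit. -/
def syzygy : Hom (M.toDiagRep.induced s) (M.lower.induced s) where
  app i t := (M.syzygyAux i).restrict fun g hg r hr => by
    change g (r + 1) - M.vert i r (g r) = 0
    rw [hg r hr, hg (r + 1) (by omega), map_zero, sub_zero]
  comm_diag {i j} a t _ hs g := Subtype.ext (funext fun r => by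
    change M.diag a (r + 1) (g.1 (r + 2)) - M.vert j r (M.diag a r (g.1 (r + 1))) =
      M.diag a (r + 1) (g.1 (r + 2) - M.vert i (r + 1) (g.1 (r + 1)))
    rw [map_sub]
    congr 1
    -- The mesh relation is available only up to level `s`; above it, both terms vanish because `g`
    -- is supported below `t + 1 ≤ s`.
    by_cases hr : r + 2 ≤ s
    · exact (M.mesh a r hr _).symm
    · rw [g.2 (r + 1) (by omega)]
      simp)
  comm_vert i t _ _ g := rfl

theorem syzygy_injective (i : V) (t : ℕ) : Function.Injective (M.syzygy.app i t) :=
  fun g g' e => Subtype.ext (funext fun r => by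
    rw [← M.counitAux_syzygyAux i r g.1, ← M.counitAux_syzygyAux i r g'.1]
    exact congrArg (fun f : M.lower.below i t => M.counitAux i r f.1) e)

theorem syzygy_exact (i : V) (t : ℕ) :
    Function.Exact (M.syzygy.app i t) (M.counit.app i t) := fun f => by
  constructor
  · intro e
    refine ⟨⟨fun r => M.counitAux i r f.1, fun r hr => ?_⟩,
      Subtype.ext (M.syzygyAux_counitAux i f.1)⟩
    -- The partial sum at `t` is zero by assumption, and from there on no new terms enter, so the
    -- later ones stay zero.
    induction r, hr using Nat.le_induction with
    | base => exact e
    | succ r hr ih =>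
      exact (M.counitAux_succ_of_eq_zero i r f.1 (f.2 r hr)).trans
        ((congrArg _ ih).trans (map_zero _))
  · rintro ⟨g, rfl⟩
    exact (M.counitAux_syzygyAux i t g.1).trans (g.2 t le_rfl)

/-- The family with a single nonzero vector, at the top level. -/
def _root_.DiagRep.top (L : DiagRep.{w} k V) (i : V) (t : ℕ) : L.obj i t →ₗ[k] L.below i (t + 1) :=
  (LinearMap.single k (L.obj i) t).codRestrict _ fun m r hr =>
    Pi.single_eq_of_ne (by omega) _

theorem counitAux_eq_zero (i : V) (t : ℕ) (f : ∀ r, M.obj i (r + 1)) (h : ∀ r, r < t → f r = 0) :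
    M.counitAux i t f = 0 := by
  induction t with
  | zero => rfl
  | succ t ih => rw [counitAux_succ, ih fun r hr => h r (by omega), h t (by omega)]; simp

theorem counit_top (i : V) (t : ℕ) (m : M.obj i (t + 1)) :
    M.counit.app i (t + 1) (M.lower.top i t m) = m := by
  change M.counitAux i (t + 1) (Pi.single t m) = m
  rw [counitAux_succ, M.counitAux_eq_zero i t (Pi.single t m) fun r hr =>
    Pi.single_eq_of_ne (M := fun r => M.obj i (r + 1)) (by omega) _, map_zero, zero_add]
  exact Pi.single_eq_same (M := fun r => M.obj i (r + 1)) t m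

theorem counit_surjective (i : V) (t : ℕ) (ht : 1 ≤ t) :
    Function.Surjective (M.counit.app i t) := by
  obtain ⟨t, rfl⟩ : ∃ r, t = r + 1 := ⟨t - 1, by omega⟩
  exact fun m => ⟨_, M.counit_top i t m⟩

end NilRep

/-! ### Free representations of the diagonal arrows -/

/-- The paths of diagonal arrows that start at the vertex `i` in level `t < s`, indexed by the vertex
and the level where they end. -/
inductive DiagPath {V : Type u} [Quiver.{v} V] (s : ℕ) (i : V) (t : ℕ) : V → ℕ → Type (max u v)
  | nil (h : t < s) : DiagPath s i t i t
  | cons {j l : V} {r : ℕ} (p : DiagPath s i t j (r + 1)) (a : j ⟶ l) : DiagPath s i t l r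

theorem DiagPath.lt {i j : V} {t r : ℕ} (p : DiagPath s i t j r) : r < s := by
  induction p with
  | nil h => exact h
  | cons p a ih => omega

namespace DiagRep

section Free

variable (k s)
variable (X : V → ℕ → Type w) [∀ i t, AddCommGroup (X i t)] [∀ i t, Module k (X i t)]

/-- The direct sum of the vector spaces of a family over the paths with a given end. -/
def WordSpace (s : ℕ) (X : V → ℕ → Type w) [∀ i t, AddCommGroup (X i t)] (j : V) (r : ℕ) :
    Type (max u v w) :=
  DirectSum (Σ (i : V) (t : ℕ), DiagPath s i t j r) fun q => X q.1 q.2.1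

instance (j : V) (r : ℕ) : AddCommGroup (WordSpace s X j r) :=
  inferInstanceAs (AddCommGroup (DirectSum _ _))

instance (j : V) (r : ℕ) : Module k (WordSpace s X j r) :=
  inferInstanceAs (Module k (DirectSum _ _))

namespace WordSpace

open Classical in
/-- The inclusion of the component of a path. -/
def word {i j : V} {t r : ℕ} (p : DiagPath s i t j r) : X i t →ₗ[k] WordSpace s X j r :=
  DirectSum.lof k (Σ (i : V) (t : ℕ), DiagPath s i t j r) (fun q => X q.1 q.2.1) ⟨i, t, p⟩

variable {k s X}

open Classical in
/-- The linear map on a direct sum over paths with given values on words. -/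
def fromWords {W : Type*} [AddCommGroup W] [Module k W] {j : V} {r : ℕ}
    (f : ∀ (i : V) (t : ℕ) (_ : DiagPath s i t j r), X i t →ₗ[k] W) : WordSpace s X j r →ₗ[k] W :=
  DirectSum.toModule k _ _ fun q => f q.1 q.2.1 q.2.2

theorem fromWords_word {W : Type*} [AddCommGroup W] [Module k W] {j : V} {r : ℕ}
    (f : ∀ (i : V) (t : ℕ) (_ : DiagPath s i t j r), X i t →ₗ[k] W) {i : V} {t : ℕ}
    (p : DiagPath s i t j r) (m : X i t) : fromWords f (word k s X p m) = f i t p m := by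
  classical
  exact DirectSum.toModule_lof (φ := fun q : Σ (i : V) (t : ℕ), DiagPath s i t j r =>
    f q.1 q.2.1 q.2.2) k ⟨i, t, p⟩ m

end WordSpace

/-- The free representation of the diagonal arrows on a family of vector spaces in levels below
`s`. -/
def free : DiagRep.{max u v w} k V where
  obj j r := WordSpace s X j r
  diag a _ := WordSpace.fromWords fun _ _ p => WordSpace.word k s X (p.cons a)

/-- The inclusion of the component of a path. -/
def word {i j : V} {t r : ℕ} (p : DiagPath s i t j r) : X i t →ₗ[k] (free k s X).obj j r :=
  WordSpace.word k s X p

variable {k s X}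

theorem free_ext {W : Type*} [AddCommGroup W] [Module k W] {j : V} {r : ℕ}
    {f g : (free k s X).obj j r →ₗ[k] W}
    (h : ∀ (i : V) (t : ℕ) (p : DiagPath s i t j r) m, f (word k s X p m) = g (word k s X p m)) :
    f = g := by
  classical
  refine DirectSum.linearMap_ext k fun q => LinearMap.ext fun m => ?_
  exact h q.1 q.2.1 q.2.2 m

/-- The linear map on a component of the free representation with given values on words. -/
def fromWords {W : Type*} [AddCommGroup W] [Module k W] {j : V} {r : ℕ}
    (f : ∀ (i : V) (t : ℕ) (_ : DiagPath s i t j r), X i t →ₗ[k] W) :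
    (free k s X).obj j r →ₗ[k] W :=
  WordSpace.fromWords f

@[simp] theorem fromWords_word {W : Type*} [AddCommGroup W] [Module k W] {j : V} {r : ℕ}
    (f : ∀ (i : V) (t : ℕ) (_ : DiagPath s i t j r), X i t →ₗ[k] W) {i : V} {t : ℕ}
    (p : DiagPath s i t j r) (m : X i t) : fromWords f (word k s X p m) = f i t p m :=
  WordSpace.fromWords_word f p m

theorem free_diag_word {i j l : V} {t r : ℕ} (p : DiagPath s i t j (r + 1)) (a : j ⟶ l)
    (m : X i t) : (free k s X).diag a r (word k s X p m) = word k s X (p.cons a) m :=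
  WordSpace.fromWords_word (fun _ _ p => WordSpace.word k s X (p.cons a)) p m

/-- The action of a path of diagonal arrows. -/
def pathMap (L : DiagRep.{w} k V) {i : V} {t : ℕ} : ∀ {j : V} {r : ℕ}, DiagPath s i t j r →
    (L.obj i t →ₗ[k] L.obj j r)
  | _, _, .nil _ => LinearMap.id
  | _, _, .cons p a => L.diag a _ ∘ₗ pathMap L p

/-- The morphism from the free representation given by linear maps on the generators. -/
def lift {L : DiagRep.{w'} k V} (φ : ∀ i t, X i t →ₗ[k] L.obj i t) :
    Hom (free k s X) L where
  app j r := fromWords fun i t p => L.pathMap p ∘ₗ φ i t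
  comm {j l} a r m := by
    refine LinearMap.congr_fun
      (f := (fromWords fun i t p => L.pathMap p ∘ₗ φ i t) ∘ₗ (free k s X).diag a r)
      (g := L.diag a r ∘ₗ fromWords fun i t p => L.pathMap p ∘ₗ φ i t) (free_ext fun i t p m => ?_) m
    rw [LinearMap.comp_apply, LinearMap.comp_apply, free_diag_word, fromWords_word, fromWords_word]
    rfl

theorem lift_word {L : DiagRep.{w'} k V} (φ : ∀ i t, X i t →ₗ[k] L.obj i t) {i j : V}
    {t r : ℕ} (p : DiagPath s i t j r) (m : X i t) :
    (lift φ).app j r (word k s X p m) = L.pathMap p (φ i t m) :=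
  fromWords_word (fun i t p => L.pathMap p ∘ₗ φ i t) p m

end Free

/-! ### The standard resolution over the diagonal arrows -/

section Resolution

variable (s) (L : DiagRep.{w} k V)

/-- The generators of the kernel of the counit: a vector for each diagonal arrow that ends at the
given vertex. -/
abbrev Sources (j : V) (t : ℕ) : Type (max u v w) :=
  DirectSum {_a : Σ i : V, i ⟶ j // t + 1 < s} fun a => L.obj a.1.1 (t + 1)

open Classical in
/-- The generator given by a diagonal arrow. -/
def source {i j : V} (a : i ⟶ j) (t : ℕ) (h : t + 1 < s) : L.obj i (t + 1) →ₗ[k] L.Sources s j t :=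
  DirectSum.lof k {_a : Σ i : V, i ⟶ j // t + 1 < s} (fun a => L.obj a.1.1 (t + 1)) ⟨⟨i, a⟩, h⟩

/-- The counit of the free representations. -/
def freeCounit : Hom (free k s L.obj) L := lift fun _ _ => LinearMap.id

theorem freeCounit_word {i j : V} {t r : ℕ} (p : DiagPath s i t j r) (m : L.obj i t) :
    (L.freeCounit s).app j r (word k s L.obj p m) = L.pathMap p m :=
  lift_word _ p m

open Classical in
/-- The relations on the generators of a representation. -/
def relation (j : V) (t : ℕ) : L.Sources s j t →ₗ[k] (free k s L.obj).obj j t :=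
  DirectSum.toModule k _ _ fun a =>
    word k s L.obj ((DiagPath.nil a.2).cons a.1.2) -
      word k s L.obj (DiagPath.nil (Nat.lt_of_succ_lt a.2)) ∘ₗ L.diag a.1.2 t

theorem relation_source {i j : V} (a : i ⟶ j) (t : ℕ) (h : t + 1 < s) (m : L.obj i (t + 1)) :
    L.relation s j t (L.source s a t h m) = word k s L.obj ((DiagPath.nil h).cons a) m -
      word k s L.obj (DiagPath.nil (Nat.lt_of_succ_lt h)) (L.diag a t m) := by
  classical
  exact DirectSum.toModule_lof k _ _

/-- The kernel of the counit of the free representations. -/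
def freeSyzygy : Hom (free k s (L.Sources s)) (free k s L.obj) := lift (L.relation s)

/-- The splitting of a word along all its arrows. -/
def splitWord {i : V} {t : ℕ} : ∀ {j : V} {r : ℕ}, DiagPath s i t j r →
    (L.obj i t →ₗ[k] (free k s (L.Sources s)).obj j r)
  | _, _, .nil _ => 0
  | _, _, .cons p a => (free k s (L.Sources s)).diag a _ ∘ₗ splitWord p +
      word k s (L.Sources s) (.nil (Nat.lt_of_succ_lt p.lt)) ∘ₗ L.source s a _ p.lt ∘ₗ L.pathMap p

/-- The contracting homotopy of the resolution by free representations. -/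
def split (j : V) (r : ℕ) : (free k s L.obj).obj j r →ₗ[k] (free k s (L.Sources s)).obj j r :=
  fromWords fun _ _ p => L.splitWord s p

theorem split_word {i j : V} {t r : ℕ} (p : DiagPath s i t j r) (m : L.obj i t) :
    L.split s j r (word k s L.obj p m) = L.splitWord s p m :=
  fromWords_word (fun _ _ p => L.splitWord s p) p m

theorem splitWord_cons {i j l : V} {t r : ℕ} (p : DiagPath s i t j (r + 1)) (a : j ⟶ l)
    (m : L.obj i t) : L.splitWord s (p.cons a) m =
      (free k s (L.Sources s)).diag a r (L.splitWord s p m) +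
        word k s (L.Sources s) (.nil (Nat.lt_of_succ_lt p.lt))
          (L.source s a r p.lt (L.pathMap p m)) := rfl

/-- The homotopy commutes with a diagonal arrow up to one term, which records the arrow just added.
This is the recursion of `splitWord` extended linearly. -/
theorem split_diag {j l : V} (a : j ⟶ l) (r : ℕ) (h : r + 1 < s)
    (x : (free k s L.obj).obj j (r + 1)) :
    L.split s l r ((free k s L.obj).diag a r x) =
      (free k s (L.Sources s)).diag a r (L.split s j (r + 1) x) +
        word k s (L.Sources s) (.nil (Nat.lt_of_succ_lt h))
          (L.source s a r h ((L.freeCounit s).app j (r + 1) x)) := by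
  refine LinearMap.congr_fun (f := L.split s l r ∘ₗ (free k s L.obj).diag a r)
    (g := (free k s (L.Sources s)).diag a r ∘ₗ L.split s j (r + 1) +
        word k s (L.Sources s) (.nil (Nat.lt_of_succ_lt h)) ∘ₗ
          L.source s a r h ∘ₗ (L.freeCounit s).app j (r + 1)) (free_ext fun i t p m => ?_) x
  simp only [LinearMap.add_apply, LinearMap.comp_apply, free_diag_word, split_word,
    freeCounit_word, splitWord_cons]

theorem freeSyzygy_word_nil (j : V) (r : ℕ) (h : r < s) (m : L.Sources s j r) :
    (L.freeSyzygy s).app j r (word k s (L.Sources s) (.nil h) m) = L.relation s j r m :=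
  lift_word _ _ m

/-- Each letter of a word `p` contributes the difference of letting it act on the vector and keeping
it in the word; these telescope to `p ⊗ m - 1 ⊗ p m`. -/
theorem freeSyzygy_split (j : V) (r : ℕ) (h : r < s) (x : (free k s L.obj).obj j r) :
    (L.freeSyzygy s).app j r (L.split s j r x) =
      x - word k s L.obj (.nil h) ((L.freeCounit s).app j r x) := by
  refine LinearMap.congr_fun (f := (L.freeSyzygy s).app j r ∘ₗ L.split s j r)
    (g := LinearMap.id - word k s L.obj (.nil h) ∘ₗ (L.freeCounit s).app j r)
    (free_ext fun i t p m => ?_) x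
  simp only [LinearMap.sub_apply, LinearMap.comp_apply, LinearMap.id_apply, split_word,
    freeCounit_word]
  clear x
  induction p with
  | nil h =>
    change (L.freeSyzygy s).app i t 0 = word k s L.obj _ m - word k s L.obj _ m
    rw [map_zero, sub_self]
  | cons p a ih =>
    rw [splitWord_cons, map_add, (L.freeSyzygy s).comm, ih p.lt, freeSyzygy_word_nil,
      relation_source, map_sub, free_diag_word, free_diag_word]
    exact sub_add_sub_cancel _ _ _

theorem sources_ext {W : Type*} [AddCommGroup W] [Module k W] {j : V} {t : ℕ}
    {f g : L.Sources s j t →ₗ[k] W}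
    (h : ∀ (i : V) (a : i ⟶ j) (ht : t + 1 < s) m,
      f (L.source s a t ht m) = g (L.source s a t ht m)) : f = g := by
  classical
  refine DirectSum.linearMap_ext k fun a => LinearMap.ext fun m => ?_
  exact h a.1.1 a.1.2 a.2 m

/-- On a generator, `a ⊗ m` and `1 ⊗ a m` both evaluate to `a m`; longer words follow since both
maps are morphisms. -/
theorem freeCounit_freeSyzygy (j : V) (r : ℕ) (x : (free k s (L.Sources s)).obj j r) :
    (L.freeCounit s).app j r ((L.freeSyzygy s).app j r x) = 0 := by
  refine LinearMap.congr_fun (f := (L.freeCounit s).app j r ∘ₗ (L.freeSyzygy s).app j r)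
    (g := 0) (free_ext fun i t p m => ?_) x
  rw [LinearMap.comp_apply, LinearMap.zero_apply]
  clear x
  induction p with
  | nil h =>
    rw [freeSyzygy_word_nil]
    refine LinearMap.congr_fun (f := (L.freeCounit s).app i t ∘ₗ L.relation s i t)
      (g := 0) (L.sources_ext s fun i' a ht m => ?_) m
    rw [LinearMap.comp_apply, relation_source, map_sub, freeCounit_word, freeCounit_word]
    exact sub_self _
  | cons p a ih => rw [← free_diag_word, Hom.comm, Hom.comm, ih, map_zero]

/-- On a generator, `a ⊗ m` splits into the generator itself and the trivial word into 0. For longer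
words the extra term of `split_diag` contains the composite of the two maps of the resolution, which
is zero. -/
theorem split_freeSyzygy (j : V) (r : ℕ) (x : (free k s (L.Sources s)).obj j r) :
    L.split s j r ((L.freeSyzygy s).app j r x) = x := by
  refine LinearMap.congr_fun (f := L.split s j r ∘ₗ (L.freeSyzygy s).app j r)
    (g := LinearMap.id) (free_ext fun i t p m => ?_) x
  rw [LinearMap.comp_apply, LinearMap.id_apply]
  clear x
  induction p with
  | nil h =>
    rw [freeSyzygy_word_nil]
    refine LinearMap.congr_fun (f := L.split s i t ∘ₗ L.relation s i t)
      (g := word k s (L.Sources s) (.nil h)) (L.sources_ext s fun i' a ht m => ?_) m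
    rw [LinearMap.comp_apply, relation_source, map_sub, split_word, split_word, splitWord_cons]
    change (free k s (L.Sources s)).diag a t 0 + word k s (L.Sources s) _ _ - 0 = _
    rw [map_zero, zero_add, sub_zero]
    rfl
  | cons p a ih =>
    rw [← free_diag_word, Hom.comm, L.split_diag s a _ p.lt, ih, freeCounit_freeSyzygy, map_zero,
      map_zero, add_zero]

theorem freeSyzygy_injective (j : V) (r : ℕ) : Function.Injective ((L.freeSyzygy s).app j r) :=
  Function.LeftInverse.injective (L.split_freeSyzygy s j r)

theorem free_exact (j : V) (r : ℕ) (h : r < s) :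
    Function.Exact ((L.freeSyzygy s).app j r) ((L.freeCounit s).app j r) := fun x => by
  constructor
  · intro e
    exact ⟨L.split s j r x, by rw [L.freeSyzygy_split s j r h, e, map_zero, sub_zero]⟩
  · rintro ⟨y, rfl⟩
    exact L.freeCounit_freeSyzygy s j r y

theorem freeCounit_surjective (j : V) (r : ℕ) (h : r < s) :
    Function.Surjective ((L.freeCounit s).app j r) := fun m =>
  ⟨_, L.freeCounit_word s (.nil h) m⟩

end Resolution

/-! ### Generators of induced modules -/

section Generators

variable (L : DiagRep.{w} k V)

/-- The family with a single nonzero vector at the top level, in the induced representation. -/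
def topInduced (s : ℕ) (i : V) (t : ℕ) : L.obj i t →ₗ[k] (L.induced s).obj i (t + 1) :=
  L.top i t

theorem induced_topInduced {L' : DiagRep.{w'} k V} (φ : Hom L L') (i : V) (t : ℕ)
    (m : L.obj i t) : (φ.induced s).app i (t + 1) (L.topInduced s i t m) =
      L'.topInduced s i t (φ.app i t m) := by
  refine Subtype.ext (funext fun r => ?_)
  change φ.app i r (Pi.single t m r) = Pi.single t (φ.app i t m) r
  by_cases h : r = t
  · subst h
    rw [Pi.single_eq_same, Pi.single_eq_same]
  · rw [Pi.single_eq_of_ne h, Pi.single_eq_of_ne h, map_zero]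

theorem diag_topInduced {i j : V} (a : i ⟶ j) (t : ℕ) (m : L.obj i (t + 1)) :
    (L.induced s).diag a (t + 1) (L.topInduced s i (t + 1) m) =
      L.topInduced s j t (L.diag a t m) := by
  refine Subtype.ext (funext fun r => ?_)
  change L.diag a r (Pi.single (M := L.obj i) (t + 1) m (r + 1)) =
    Pi.single (M := L.obj j) t (L.diag a t m) r
  by_cases h : r = t
  · subst h
    rw [Pi.single_eq_same, Pi.single_eq_same]
  · rw [Pi.single_eq_of_ne h, Pi.single_eq_of_ne (by omega), map_zero]

/-- Removing the top component leaves a family supported below `t`, and vertical arrows are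
inclusions. This drives the induction on levels in `total_induced_ext`. -/
theorem exists_eq_topInduced_add_vert (i : V) (t : ℕ) (y : (L.induced s).obj i (t + 1)) :
    ∃ m y', y = L.topInduced s i t m + (L.induced s).vert i t y' := by
  refine ⟨y.1 t, ⟨fun r => if r < t then y.1 r else 0, fun r hr => if_neg (by omega)⟩,
    Subtype.ext (funext fun r => ?_)⟩
  change y.1 r = Pi.single (M := L.obj i) t (y.1 t) r + ite _ _ _
  rcases lt_trichotomy r t with h | rfl | h
  · rw [Pi.single_eq_of_ne (by omega), if_pos h, zero_add]
  · rw [Pi.single_eq_same, if_neg (by omega), add_zero]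
  · rw [Pi.single_eq_of_ne (by omega), if_neg (by omega), add_zero]
    exact y.2 r h

variable [Fintype V]

/-- The inclusion of a component of a representation into the module of the induced
representation. -/
def generator (i : V) (t : ℕ) (h : t < s) : L.obj i t →ₗ[k] (L.induced s).Total :=
  (L.induced s).single ⟨i, t + 1, by omega, h⟩ ∘ₗ L.topInduced s i t

theorem total_generator {L' : DiagRep.{w'} k V} (φ : Hom L L') (i : V) (t : ℕ) (h : t < s)
    (m : L.obj i t) :
    (φ.induced s).total (L.generator i t h m) = L'.generator i t h (φ.app i t m) :=
  (NilRep.Hom.total_single (φ.induced s) ⟨i, t + 1, by omega, h⟩ _).trans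
    (congrArg ((L'.induced s).single ⟨i, t + 1, by omega, h⟩) (L.induced_topInduced φ i t m))

theorem _root_.NilRep.counit_generator (M : NilRep.{w} k V s) (i : V) (t : ℕ) (h : t < s)
    (m : M.obj i (t + 1)) :
    M.counit.total (M.lower.generator i t h m) = M.single ⟨i, t + 1, by omega, h⟩ m :=
  (NilRep.Hom.total_single M.counit ⟨i, t + 1, by omega, h⟩ _).trans
    (congrArg (M.single ⟨i, t + 1, by omega, h⟩) (M.counit_top i t m))

theorem generator_diag {i j : V} (a : i ⟶ j) (t : ℕ) (h : t + 1 < s) (m : L.obj i (t + 1)) :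
    L.generator j t (Nat.lt_of_succ_lt h) (L.diag a t m) =
      NilRep.ofPathAlgebra k V s (Staircase.diag k a (t + 2) (by omega) h) •
        L.generator i (t + 1) h m := by
  refine ((NilRep.mk_diag_smul (L.induced s) a (t + 1) (by omega) h _).trans ?_).symm
  rw [generator, LinearMap.comp_apply, NilRep.proj_single, diag_topInduced]
  rfl

variable {E : Type*} [AddCommGroup E] [Module (NilpotentQuiverAlgebra k V s) E]

/-- The components of `L` generate the induced module: whatever is not a generator at level `t + 1`
comes from level `t` by a vertical arrow. -/
theorem total_induced_ext {f g : (L.induced s).Total →ₗ[NilpotentQuiverAlgebra k V s] E}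
    (h : ∀ i t h m, f (L.generator i t h m) = g (L.generator i t h m)) : f = g := by
  have key : ∀ (i : V) (t : ℕ) (h1 : 1 ≤ t) (ht : t ≤ s) (y : (L.induced s).obj i t),
      f ((L.induced s).single ⟨i, t, h1, ht⟩ y) = g ((L.induced s).single ⟨i, t, h1, ht⟩ y) := by
    intro i t h1
    induction t, h1 using Nat.le_induction with
    | base =>
      intro ht y
      obtain ⟨m, y', rfl⟩ := L.exists_eq_topInduced_add_vert i 0 y
      have := (L.induced s).subsingleton_zero i
      rw [Subsingleton.elim y' 0, map_zero, add_zero]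
      exact h i 0 ht m
    | succ t h1 ih =>
      intro ht y
      obtain ⟨m, y', rfl⟩ := L.exists_eq_topInduced_add_vert i t y
      have hv := NilRep.mk_vert_smul (L.induced s) i t h1 ht
        ((L.induced s).single ⟨i, t, h1, by omega⟩ y')
      rw [NilRep.proj_single] at hv
      rw [map_add, map_add, map_add, ← hv, map_smul, map_smul, ih]
      exact congrArg (· + _) (h i t ht m)
  ext m
  rw [← (L.induced s).sum_single_proj m, map_sum, map_sum]
  exact Finset.sum_congr rfl fun x _ => key x.base x.level x.one_le x.le_s _

end Generators

/-! ### Projectivity of induced free representations -/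

section Projective

variable [Fintype V] {X : V → ℕ → Type w} [∀ i t, AddCommGroup (X i t)] [∀ i t, Module k (X i t)]

/-- Every word arises from a trivial one by diagonal arrows, which act through the algebra by
`generator_diag`. -/
theorem total_free_ext {E : Type*} [AddCommGroup E] [Module k E]
    [Module (NilpotentQuiverAlgebra k V s) E] [IsScalarTower k (NilpotentQuiverAlgebra k V s) E]
    {f g : ((free k s X).induced s).Total →ₗ[NilpotentQuiverAlgebra k V s] E}
    (h : ∀ i t (h : t < s) m, f ((free k s X).generator i t h (word k s X (.nil h) m)) =
      g ((free k s X).generator i t h (word k s X (.nil h) m))) : f = g := by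
  refine total_induced_ext _ fun j r hr x => ?_
  refine LinearMap.congr_fun (f := f.restrictScalars k ∘ₗ (free k s X).generator j r hr)
    (g := g.restrictScalars k ∘ₗ (free k s X).generator j r hr) (free_ext fun i t p m => ?_) x
  change f ((free k s X).generator j r hr (word k s X p m)) =
    g ((free k s X).generator j r hr (word k s X p m))
  clear x
  induction p with
  | nil h0 => exact h i t h0 m
  | cons p a ih =>
    rw [← free_diag_word, generator_diag _ a _ p.lt, map_smul, map_smul, ih p.lt]

theorem idem_smul_generator (L : DiagRep.{w} k V) (i : V) (t : ℕ) (h : t < s) (m : L.obj i t) :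
    NilpotentQuiverAlgebra.vertexElt k s i (t + 1) • L.generator i t h m = L.generator i t h m := by
  have := NilRep.mk_idem_smul (L.induced s) ⟨i, t + 1, by omega, h⟩ (L.generator i t h m)
  rw [← NilpotentQuiverAlgebra.vertexElt_eq] at this
  rw [this, generator, LinearMap.comp_apply, NilRep.proj_single]

section Lifting

variable {E : Type w'} [AddCommGroup E] [Module k E] [Module (NilpotentQuiverAlgebra k V s) E]
  [IsScalarTower k (NilpotentQuiverAlgebra k V s) E]

/-- The linear map from the module of a free representation with given values on generators. -/
def liftModule (φ : ∀ i t, X i t →ₗ[k] (NilRep.ofModule k V s E).obj i (t + 1)) :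
    ((free k s X).induced s).Total →ₗ[NilpotentQuiverAlgebra k V s] E :=
  NilRep.gather k V s E ∘ₗ (NilRep.ofModule k V s E).counit.total ∘ₗ
    ((lift (L := (NilRep.ofModule k V s E).lower) φ).induced s).total

theorem liftModule_generator (φ : ∀ i t, X i t →ₗ[k] (NilRep.ofModule k V s E).obj i (t + 1))
    (i : V) (t : ℕ) (h : t < s) (m : X i t) :
    liftModule φ ((free k s X).generator i t h (word k s X (.nil h) m)) =
      NilRep.val k V s E i (t + 1) (φ i t m) := by
  have h1 : (lift (L := (NilRep.ofModule k V s E).lower) φ).app i t (word k s X (.nil h) m) =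
    φ i t m := lift_word (L := (NilRep.ofModule k V s E).lower) φ _ m
  rw [liftModule, LinearMap.comp_apply, LinearMap.comp_apply, total_generator, h1]
  refine (congrArg _ (NilRep.counit_generator _ i t h (φ i t m))).trans ?_
  exact NilRep.gather_single ⟨i, t + 1, by omega, h⟩ (φ i t m)

theorem exists_lift_generators
    (π : E →ₗ[NilpotentQuiverAlgebra k V s] ((free k s X).induced s).Total)
    (hπ : Function.Surjective π) (i : V) (t : ℕ) :
    ∃ φ : X i t →ₗ[k] (NilRep.ofModule k V s E).obj i (t + 1), ∀ (h : t < s) m,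
      π (NilRep.val k V s E i (t + 1) (φ m)) =
        (free k s X).generator i t h (word k s X (.nil h) m) := by
  by_cases h : t < s
  · obtain ⟨ψ, hψ⟩ := Module.projective_lifting_property (π.restrictScalars k)
      ((free k s X).generator i t h ∘ₗ word k s X (.nil h)) hπ
    -- The linear lift `ψ` need not land in the component of the vertex. Multiplying by the
    -- idempotent repairs this, and the image under `π` is unchanged because the idempotent fixes
    -- the generator.
    refine ⟨NilRep.toComponent k V s E i (t + 1) ∘ₗ ψ, fun _ m => ?_⟩
    have := LinearMap.congr_fun hψ m
    rw [LinearMap.comp_apply, LinearMap.restrictScalars_apply, LinearMap.comp_apply] at this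
    rw [LinearMap.comp_apply, NilRep.val_toComponent, map_smul, this, idem_smul_generator]
  · exact ⟨0, fun h' => absurd h' h⟩

/-- Vector spaces lift along `π`, so the generators do; freeness extends the lift to a module map,
and the composite with `π` need only be compared on generators. -/
theorem exists_section (π : E →ₗ[NilpotentQuiverAlgebra k V s] ((free k s X).induced s).Total)
    (hπ : Function.Surjective π) : ∃ h, π ∘ₗ h = LinearMap.id := by
  choose φ hφ using exists_lift_generators π hπ
  refine ⟨liftModule φ, total_free_ext (k := k) fun i t h m => ?_⟩
  rw [LinearMap.comp_apply, liftModule_generator]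
  exact hφ i t h m

end Lifting

instance total_free_projective :
    Module.Projective (NilpotentQuiverAlgebra k V s) ((free k s X).induced s).Total :=
  Module.Projective.of_lifting_property'' fun f hf => exists_section (k := k) f hf

end Projective

end DiagRep

/-! ### Projective dimensions -/

theorem ModuleCat.hasProjectiveDimensionLT_of_exact {R : Type u} [Ring R] {A B C : Type v}
    [AddCommGroup A] [AddCommGroup B] [AddCommGroup C] [Module R A] [Module R B] [Module R C]
    (f : A →ₗ[R] B) (g : B →ₗ[R] C) (hf : Function.Injective f) (hfg : Function.Exact f g)
    (hg : Function.Surjective g) (n : ℕ) (hA : HasProjectiveDimensionLT (ModuleCat.of R A) n)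
    (hB : HasProjectiveDimensionLT (ModuleCat.of R B) (n + 1)) :
    HasProjectiveDimensionLT (ModuleCat.of R C) (n + 1) := by
  let S : ShortComplex (ModuleCat.{v} R) := ShortComplex.mk (ModuleCat.ofHom f) (ModuleCat.ofHom g)
    (by ext x; exact hfg.apply_apply_eq_zero x)
  have hS : S.ShortExact :=
    { exact := (ShortComplex.ShortExact.moduleCat_exact_iff_function_exact S).2 hfg
      mono_f := (ModuleCat.mono_iff_injective _).2 hf
      epi_g := (ModuleCat.epi_iff_surjective _).2 hg }
  exact hS.hasProjectiveDimensionLT_X₃ n hA hB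

variable [Fintype V]

theorem DiagRep.hasProjectiveDimensionLT_total_free
    (X : V → ℕ → Type (max uk u v w)) [∀ i t, AddCommGroup (X i t)] [∀ i t, Module k (X i t)] :
    HasProjectiveDimensionLT
      (ModuleCat.of.{max uk u v w} (NilpotentQuiverAlgebra k V s) ((free k s X).induced s).Total) 1 :=
  projective_iff_hasProjectiveDimensionLT_one.1
    ((IsProjective.iff_projective _).1 total_free_projective)

/-- Induction is exact, so it turns the standard resolution of `L` into a projective resolution of
length one. -/
theorem DiagRep.hasProjectiveDimensionLT_total_induced (L : DiagRep.{max uk u v w} k V) :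
    HasProjectiveDimensionLT
      (ModuleCat.of.{max uk u v w} (NilpotentQuiverAlgebra k V s) (L.induced s).Total) 2 :=
  ModuleCat.hasProjectiveDimensionLT_of_exact
    ((L.freeSyzygy s).induced s).total ((L.freeCounit s).induced s).total
    (NilRep.Hom.total_injective _ fun i t _ ht =>
      Hom.induced_injective _ (fun j r _ => L.freeSyzygy_injective s j r) i t ht)
    (NilRep.Hom.total_exact _ _ fun i t _ ht =>
      Hom.induced_exact _ _ (fun j r hr => L.free_exact s j r hr) i t ht)
    (NilRep.Hom.total_surjective _ fun i t _ ht =>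
      Hom.induced_surjective _ (fun j r hr => L.freeCounit_surjective s j r hr) i t ht)
    1 (hasProjectiveDimensionLT_total_free.{w, v, u, uk} _)
    (have := hasProjectiveDimensionLT_total_free.{w, v, u, uk} (k := k) (s := s) L.obj
     hasProjectiveDimensionLT_of_ge
      (ModuleCat.of.{max uk u v w} (NilpotentQuiverAlgebra k V s)
        ((free k s L.obj).induced s).Total) 1 2 (by omega))

theorem NilRep.hasProjectiveDimensionLT_total (M : NilRep.{max uk u v w} k V s) :
    HasProjectiveDimensionLT
      (ModuleCat.of.{max uk u v w} (NilpotentQuiverAlgebra k V s) M.Total) 3 :=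
  ModuleCat.hasProjectiveDimensionLT_of_exact M.syzygy.total M.counit.total
    (Hom.total_injective _ fun i t _ _ => M.syzygy_injective i t)
    (Hom.total_exact _ _ fun i t _ _ => M.syzygy_exact i t)
    (Hom.total_surjective _ fun i t ht _ => M.counit_surjective i t ht)
    2 (DiagRep.hasProjectiveDimensionLT_total_induced.{w, v, u, uk} M.toDiagRep)
    (have := DiagRep.hasProjectiveDimensionLT_total_induced.{w, v, u, uk} (s := s) M.lower
     hasProjectiveDimensionLT_of_ge _ 2 3 (by omega))

end

theorem mainTheorem8 (k : Type uk) [Field k] (V : Type u) [Quiver.{v} V] [Fintype V]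
    [∀ i j : V, Finite (i ⟶ j)] (s : ℕ) (hs : 1 ≤ s) :
    globalDimension.{w} (NilpotentQuiverAlgebra k V s) ≤ 2 := by
  refine iSup_le fun M => (projectiveDimension_le_iff M 2).2 ?_
  -- Only the algebra acts on `M`; its `k`-structure comes from restriction along the structure map.
  let _ : Module k M := Module.compHom M (algebraMap k (NilpotentQuiverAlgebra k V s))
  have : IsScalarTower k (NilpotentQuiverAlgebra k V s) M :=
    ⟨fun c n m => by rw [Algebra.smul_def, mul_smul]; rfl⟩
  have := NilRep.hasProjectiveDimensionLT_total.{w, v, u, uk} (NilRep.ofModule k V s M)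
  exact hasProjectiveDimensionLT_of_iso (NilRep.gatherEquiv k V s M).toModuleIso 3
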